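/- \textbf{Setting.} A plant is operated over stages $\mathcal I=\{0,\dots,I-1\}$, $I\ge 2$, with modes $\mathcal X''=\{\mathsf O,\mathsf M,\mathsf A\}$ (operational, fully mothballed, abandoned), $\mathcal X'=\{\mathsf O,\mathsf M\}$ and initial mode $x_0\in\mathcal X'$. Mothballing and reactivation take $N^{\mathsf M}\ge1$ and $N^{\mathsf R}\ge 1$ stages. For $i\le I-2$ the feasible actions $\mathcal A_i(x)$ are: in mode $\mathsf O$: abandon, produce, suspend, and (if $i\le I-1-N^{\mathsf M}$) start mothballing; in mode $\mathsf M$: abandon, stay, and (if $i\le I-1-N^{\mathsf R}$) start reactivation; in mode $\mathsf A$: abandon. For $i=I-1$ only abandoning is feasible. Let $r(x,s,a)$ be the one-stage reward at spot prices $s=(s^{\mathrm E},s^{\mathrm C},s^{\mathrm N})$: production yields $(s^{\mathrm E}-\gamma_{\mathrm C}s^{\mathrm C}-\gamma_{\mathrm N}s^{\mathrm N})Q-C_{\mathsf P}$; suspension, starting mothballing, staying mothballed and starting reactivation yield $-C_{\mathsf S},-I_{\mathsf M},-C_{\mathsf M},-I_{\mathsf R}$; abandoning from $\mathsf O$ or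 $\mathsf M$ yields the salvage value $S$, and in $\mathsf A$ it yields $0$; here $C_{\mathsf M}<C_{\mathsf S}<C_{\mathsf P}$. Let $f'(x,a)\in\mathcal X''$ be the resulting mode ($\mathsf O$ after produce, suspend and reactivation; $\mathsf M$ after start mothballing and stay; $\mathsf A$ after abandon), and $g(i,x,a)$ the next decision stage: $i+N^{\mathsf M}$ for start mothballing, $i+N^{\mathsf R}$ for start reactivation, $i+1$ otherwise. Let $\delta>0$ be the discount factor. The vector $F_i$ of forward curves at stage $i$ consists of nonnegative prices $F^c_{i,j}$, $j\ge i$, of three commodities, with spot prices $F^c_{i,i}$, and follows a Markov process. Given are $L\ge 1$ sample paths $(F^l_i)_{i\in\mathcal I}$ with the common initial value $F_0$, with spot prices $s^l_i$, and, for $i\notin\{0,I-1\}$, measurable basis functions $\phi_{i,b}$, $b\in\mathcal B_i=\{1,\dots,B_i\}$, whose conditional expectations below are finite. Put $$\Delta^l_i\phi_{j,b}=\delta^{\,j-i}\bigl(\phi_{j,b}(F^l_j)-\mathbb E[\phi_{j,b}(F_j)\mid F_i=F^l_i]\bigr),\qquad i<j .$$ For coefficients $\beta=(\beta_{i,x,b})$,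 $i\in\mathcal I\setminus\{0,I-1\}$, $x\in\mathcal X'$, $b\in\mathcal B_i$, and values $U=(U^l)_{l}$, $U^l=(U^l_i(x))$, indexed by $(0,x_0)$ and all $(i,x)$ with $i\ge1$, $x\in\mathcal X''$, consider the constraints, one for each $l$, each such $(i,x)$ and each $a\in\mathcal A_i(x)$, $$U^l_i(x)-\delta\,U^l_{g(i,x,a)}(f'(x,a))+\sum_{b}\beta_{g(i,x,a),f'(x,a),b}\,\Delta^l_i\phi_{g(i,x,a),b}\ \ge\ r(x,s^l_i,a),$$ where the $U$ term at $g(i,x,a)$ is absent if $i=I-1$, and the sum is absent if $f'(x,a)=\mathsf A$ or $g(i,x,a)\ge I-1$. Write them as $QU+G\beta\ge r$. For each $(i,x)$ let $G_{i,x}$ be the block of $G$ in the columns $(i,x,b)$, $b\in\mathcal B_i$, let $W_{i,x}$ be an orthogonal matrix whose columns are eigenvectors of $G_{i,x}^{\mathsf T}G_{i,x}$, and let $G^\perp$ be obtained from $G$ by replacing each block $G_{i,x}$ by $G_{i,x}W_{i,x}$. P2LP is $$\min_{\beta,U}\ \frac1L\sum_{l}U^l_0(x_0)\quad\text{s.t.}\quad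 QU+G^\perp\beta\ge r .$$ For fixed $\beta$ and $l$, the path LP minimizes $U^l_0(x_0)$ over $U^l$ subject to the rows of $QU+G^\perp\beta\ge r$ of path $l$; $\mathrm{OBJ}(\beta)$ is the average over $l$ of the optimal values of the path LPs. An optimal solution of a path LP is non-degenerate if its active constraints have linearly independent coefficient vectors and are exactly as many as the variables $U^l_i(x)$. \textbf{Idealized cyclic block coordinate descent (CBCD).} Let $\mathcal P_1,\dots,\mathcal P_P$ be a partition of $(\mathcal I\setminus\{0,I-1\})\times\mathcal X'$ into non-empty sets and $\beta(\mathcal P_p)$ the corresponding blocks of $\beta$. Let $\beta^{\mathrm L},\beta^{\mathrm H}$ be finite bounds such that P2LP has an optimal solution whose $\beta$ part satisfies $\beta^{\mathrm L}\le\beta\le\beta^{\mathrm H}$. Starting from $\beta^0$ with $\beta^{\mathrm L}\le\beta^0\le\beta^{\mathrm H}$, in iteration $h=1,2,\dots$, for $p=1,\dots,P$, the method lets $\beta^h(\mathcal P_p)$ be the $p$-th block of an optimal solution of P2LP with the additional constraints $\beta^{\mathrm L}\le\beta\le\beta^{\mathrm H}$, $\beta(\mathcal P_{p'})=\beta^h(\mathcal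 P_{p'})$ for $p'<p$, and $\beta(\mathcal P_{p'})=\beta^{h-1}(\mathcal P_{p'})$ for $p'>p$. Let $(\beta^h)_{h\ge0}$ be any infinite sequence so generated. \textbf{Proposition 3.} (a) If each linear program solved by the method has a unique optimal vector $\beta$, then $(\beta^h)$ converges. Moreover, if the zero-tolerance stopping test is met, that is, $\mathrm{OBJ}(\beta^{h+1})=\mathrm{OBJ}(\beta^{h})$ for some $h\ge 0$, then $\beta^k=\beta^h$ for all $k\ge h$, so that the vector returned by the method is this limit. (b) Suppose that $(\beta^h)$ converges to $\overline\beta$ (whether or not the solutions in (a) are unique), that $\beta^{\mathrm L}<\overline\beta<\beta^{\mathrm H}$ in each component, and that for each $l$ the path LP at $\overline\beta$ has a non-degenerate optimal solution. Then, for every collection $U=(U^l)_l$ of optimal solutions $U^l$ of the path LPs at $\overline\beta$ (in particular for the non-degenerate ones), $(\overline\beta,U)$ is an optimal solution of P2LP. -/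

import Mathlib

open MeasureTheory ProbabilityTheory Filter Topology
open scoped NNReal Matrix

noncomputable section

namespace EnergyPO

/-- The commodities: corn, ethanol and natural gas. -/
inductive Commodity
  | corn
  | ethanol
  | gas

/-- The operating modes that carry decision variables: operational (`O`), fully mothballed
(`M_{N^M}`) and abandoned (`A`). The set `X'` consists of the first two, `X''` of all three. -/
inductive Mode
  | operational
  | mothballed
  | abandoned
  deriving DecidableEq

instance : Fintype Mode :=
  ⟨{Mode.operational, Mode.mothballed, Mode.abandoned}, fun x => by cases x <;> simp⟩

/-- The actions available in these modes: `A`, `P`, `S`, `M_1` (start mothballing),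
`M_{N^M}` (stay fully mothballed) and `R_1` (start reactivation). -/
inductive Action
  | abandon
  | produce
  | suspend
  | startMothball
  | stayMothballed
  | startReactivation
  deriving DecidableEq

instance : Fintype Action :=
  ⟨{Action.abandon, Action.produce, Action.suspend, Action.startMothball, Action.stayMothballed,
    Action.startReactivation}, fun a => by cases a <;> simp⟩

/-- The data of the plant, of the horizon, and the initial operating mode `x₀ ∈ X'`. -/
structure Plant where
  /-- number of stages; the stage set is `{0, …, I - 1}` -/
  I : ℕ
  two_le_I : 2 ≤ I
  /-- durations (in stages) of mothballing and reactivation -/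
  NM : ℕ
  NR : ℕ
  NM_pos : 0 < NM
  NR_pos : 0 < NR
  /-- production quantity and input requirements per unit of output -/
  Q : ℝ
  γC : ℝ
  γN : ℝ
  /-- costs of producing, suspending, staying mothballed -/
  costP : ℝ
  costS : ℝ
  costM : ℝ
  costS_lt : costS < costP
  costM_lt : costM < costS
  /-- costs of initiating mothballing and reactivation, and the net salvage value -/
  initM : ℝ
  initR : ℝ
  salvage : ℝ
  /-- discount factor per stage -/
  δ : ℝ
  δ_pos : 0 < δ
  /-- initial operating mode -/
  x₀ : Mode
  x₀_ne : x₀ ≠ Mode.abandoned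

namespace Plant

variable (M : Plant)

/-- Vectors of forward curves at stage `i`: nonnegative prices `F^c_{i,j}` for each commodity `c`
and each delivery stage `j ≥ i`. -/
abbrev Curve (i : Fin M.I) : Type := Commodity × {j : Fin M.I // i ≤ j} → ℝ≥0

/-- The spot price of commodity `c` at stage `i`, which is `F^c_{i,i}`. -/
def spot {i : Fin M.I} (F : M.Curve i) (c : Commodity) : ℝ := F (c, ⟨i, le_refl i⟩)

/-- The feasible action set `A_i(x)`. At the last stage abandonment is compulsory. -/
def actions (i : Fin M.I) (x : Mode) : Finset Action :=
  if (i : ℕ) + 1 = M.I then {Action.abandon}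
  else match x with
    | .operational =>
        if (i : ℕ) + M.NM ≤ M.I - 1 then
          {Action.abandon, Action.startMothball, Action.produce, Action.suspend}
        else {Action.abandon, Action.produce, Action.suspend}
    | .mothballed =>
        if (i : ℕ) + M.NR ≤ M.I - 1 then
          {Action.abandon, Action.stayMothballed, Action.startReactivation}
        else {Action.abandon, Action.stayMothballed}
    | .abandoned => {Action.abandon}

/-- The per stage reward `r(x, s, a)`, with `s` the vector of spot prices
(only its values at feasible mode-action pairs matter). -/
def reward (x : Mode) (s : Commodity → ℝ) (a : Action) : ℝ :=
  match x, a with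
  | .operational, .produce =>
      (s .ethanol - M.γC * s .corn - M.γN * s .gas) * M.Q - M.costP
  | .operational, .suspend => -M.costS
  | .operational, .startMothball => -M.initM
  | .mothballed, .stayMothballed => -M.costM
  | .mothballed, .startReactivation => -M.initR
  | .operational, .abandon => M.salvage
  | .mothballed, .abandon => M.salvage
  | _, _ => 0

/-- The modified mode transition function `f'(x, a)`. -/
def nextMode (x : Mode) (a : Action) : Mode :=
  match x, a with
  | .operational, .produce => .operational
  | .operational, .suspend => .operational
  | .mothballed, .startReactivation => .operational
  | .operational, .startMothball => .mothballed
  | .mothballed, .stayMothballed => .mothballed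
  | _, _ => .abandoned

/-- The stage transition function `g(i, x, a)`. -/
def nextStage (i : Fin M.I) (x : Mode) (a : Action) : ℕ :=
  match x, a with
  | .operational, .startMothball => i + M.NM
  | .mothballed, .startReactivation => i + M.NR
  | _, _ => i + 1

/-- Index set of the variables `U_i(x)` of one sample path: the pair `(0, x₀)` and all pairs
`(i, x)` with `i ≠ 0` and `x ∈ X''`. -/
abbrev Var : Type := {s : Fin M.I × Mode // (s.1 : ℕ) = 0 → s.2 = M.x₀}

/-- The pair `(0, x₀)`. -/
def initial : M.Var :=
  ⟨(⟨0, lt_of_lt_of_le Nat.zero_lt_two M.two_le_I⟩, M.x₀), fun _ => rfl⟩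

/-- Index set of the constraints of one sample path: a pair `(i, x)` that indexes a variable,
together with a feasible action `a ∈ A_i(x)`. -/
abbrev Row : Type := {ρ : M.Var × Action // ρ.2 ∈ M.actions ρ.1.1.1 ρ.1.1.2}

variable {M} in
/-- The stage of a constraint. -/
def Row.stage (ρ : M.Row) : Fin M.I := ρ.1.1.1.1

variable {M} in
/-- The operating mode of a constraint. -/
def Row.mode (ρ : M.Row) : Mode := ρ.1.1.1.2

variable {M} in
/-- The action of a constraint. -/
def Row.action (ρ : M.Row) : Action := ρ.1.2

/-- Index set of the value function approximations: the pairs `(i, x)` with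
`i ∉ {0, I - 1}` and `x ∈ X'`. -/
abbrev Site : Type :=
  {s : Fin M.I × Mode // 0 < (s.1 : ℕ) ∧ (s.1 : ℕ) + 1 < M.I ∧ s.2 ≠ Mode.abandoned}

variable {M} in
/-- The stage of a pair `(i, x)`. -/
def Site.stage (k : M.Site) : Fin M.I := k.1.1

variable {M} in
/-- The operating mode of a pair `(i, x)`. -/
def Site.mode (k : M.Site) : Mode := k.1.2

/-- The block of the constraint matrix that multiplies the `U` variables of one sample path. The
row of `(i, x, a)` has the entry `1` in column `(i, x)` and `-δ` in column
`(g(i,x,a), f'(x,a))`. At stage `I - 1` the latter column does not exist, since `g = I`. -/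
def Qmat : Matrix M.Row M.Var ℝ := fun ρ v =>
  (if v = ρ.1.1 then 1 else 0) -
    (if (v.1.1 : ℕ) = M.nextStage ρ.stage ρ.mode ρ.action ∧
        v.1.2 = nextMode ρ.mode ρ.action then M.δ else 0)

end Plant

/-- The market model (a time inhomogeneous Markov process of forward curves given by its transition
kernels), the Monte Carlo sample paths, and the basis functions. -/
structure Samples (M : Plant) where
  /-- `trans i j` is the conditional law of `F_j` given `F_i`, for `i < j` -/
  trans : ∀ i j : Fin M.I, Kernel (M.Curve i) (M.Curve j)
  markov : ∀ i j, i < j → IsMarkovKernel (trans i j)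
  chapman_kolmogorov : ∀ i j k, i < j → j < k → (trans j k) ∘ₖ (trans i j) = trans i k
  /-- initial forward curves -/
  F₀ : M.Curve M.initial.1.1
  /-- number of sample paths, and the paths, which start from `F₀` -/
  L : ℕ
  L_pos : 0 < L
  path : Fin L → ∀ i : Fin M.I, M.Curve i
  path_zero : ∀ l, path l M.initial.1.1 = F₀
  /-- number of basis functions per stage, and the basis functions `φ_{i,b}` -/
  B : Fin M.I → ℕ
  φ : ∀ i, Fin (B i) → M.Curve i → ℝ
  measurable_φ : ∀ i b, Measurable (φ i b)
  integrable_φ : ∀ l i j, i < j → ∀ b, Integrable (φ j b) (trans i j (path l i))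

namespace Samples

variable {M : Plant} (D : Samples M)

/-- Index set of the vector `β`: triples `(i, x, b)` with `i ∉ {0, I - 1}`, `x ∈ X'` and `b` the
index of a stage `i` basis function. -/
abbrev Col : Type := (k : M.Site) × Fin (D.B k.stage)

/-- `Δ_i^{E,l} φ_{j,b} = δ^{j-i} (φ_{j,b}(F^l_j) - E[φ_{j,b}(F_j) | F_i = F^l_i])`. -/
def Delta (l : Fin D.L) (i j : Fin M.I) (b : Fin (D.B j)) : ℝ :=
  M.δ ^ ((j : ℕ) - (i : ℕ)) *
    (D.φ j b (D.path l j) - ∫ F, D.φ j b F ∂(D.trans i j (D.path l i)))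

/-- The right-hand side of the constraint of `(l, i, x, a)`: the reward `r(x, s_i^l, a)`. -/
def rhs (l : Fin D.L) (ρ : M.Row) : ℝ :=
  M.reward ρ.mode (M.spot (D.path l ρ.stage)) ρ.action

/-- The block `G_{i,x}` of the matrix `G`. Only the rows whose transition leads to `(i, x)` are
nonzero; the other ones are kept as zero rows. -/
def Gblock (k : M.Site) : Matrix (Fin D.L × M.Row) (Fin (D.B k.stage)) ℝ := fun lρ b =>
  if M.nextStage lρ.2.stage lρ.2.mode lρ.2.action = (k.stage : ℕ) ∧
      Plant.nextMode lρ.2.mode lρ.2.action = k.mode then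
    D.Delta lρ.1 lρ.2.stage k.stage b
  else 0

/-- `W_{i,x}` is an orthogonal matrix whose columns are eigenvectors of `G_{i,x}ᵀ G_{i,x}`,
for each `(i, x)`. -/
def IsBlockPCA (W : ∀ k : M.Site, Matrix (Fin (D.B k.stage)) (Fin (D.B k.stage)) ℝ) : Prop :=
  ∀ k, W k ∈ Matrix.orthogonalGroup (Fin (D.B k.stage)) ℝ ∧
    ∀ b, ∃ ev : ℝ,
      ((D.Gblock k)ᵀ * D.Gblock k) *ᵥ (fun b' => W k b' b) = ev • (fun b' => W k b' b)

variable (W : ∀ k : M.Site, Matrix (Fin (D.B k.stage)) (Fin (D.B k.stage)) ℝ)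

/-- The rows of sample path `l` of the preconditioned matrix `G^⊥`, whose `(i, x)` block is
`G_{i,x} W_{i,x}`. -/
def Gperp (l : Fin D.L) : Matrix M.Row D.Col ℝ := fun ρ c =>
  (D.Gblock c.1 * W c.1) (l, ρ) c.2

/-- The feasible set of the linear program of sample path `l` for a fixed vector `β`, written with
the preconditioned constraints `Q U + G^⊥ β ≥ r`. -/
def pathFeasible (l : Fin D.L) (β : D.Col → ℝ) : Set (M.Var → ℝ) :=
  {V | ∀ ρ, D.rhs l ρ ≤ (M.Qmat *ᵥ V) ρ + (D.Gperp W l *ᵥ β) ρ}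

/-- `V` is an optimal solution of the linear program of sample path `l` for the vector `β`, which
minimizes `U_0(x₀)`. -/
def IsPathOptimal (l : Fin D.L) (β : D.Col → ℝ) (V : M.Var → ℝ) : Prop :=
  V ∈ D.pathFeasible W l β ∧
    ∀ V' ∈ D.pathFeasible W l β, V M.initial ≤ V' M.initial

/-- The constraints of the linear program of sample path `l` that are active at `V`. -/
def pathActive (l : Fin D.L) (β : D.Col → ℝ) (V : M.Var → ℝ) : Set M.Row :=
  {ρ | (M.Qmat *ᵥ V) ρ + (D.Gperp W l *ᵥ β) ρ = D.rhs l ρ}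

/-- `V` is a nondegenerate basic solution of the linear program of sample path `l`: the rows of the
constraints that are active at `V` are linearly independent, and there are exactly as many of them
as variables. -/
def IsPathNondegenerate (l : Fin D.L) (β : D.Col → ℝ) (V : M.Var → ℝ) : Prop :=
  LinearIndependent ℝ (fun ρ : D.pathActive W l β V => M.Qmat ρ.1) ∧
    (D.pathActive W l β V).ncard = Fintype.card M.Var

/-- The value `OBJ(β)`: the sample average of the optimal values `U_0^{l,β}(x₀)`. -/
def OBJ (β : D.Col → ℝ) : ℝ :=
  (1 / (D.L : ℝ)) * ∑ l, sInf ((fun V : M.Var → ℝ => V M.initial) '' D.pathFeasible W l β)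

/-- The feasible set of P2LP, whose elements are the pairs `(β, U)`. -/
def feasible : Set ((D.Col → ℝ) × (Fin D.L → M.Var → ℝ)) :=
  {z | ∀ l, z.2 l ∈ D.pathFeasible W l z.1}

/-- The objective function of P2LP. -/
def objective (z : (D.Col → ℝ) × (Fin D.L → M.Var → ℝ)) : ℝ :=
  (1 / (D.L : ℝ)) * ∑ l, z.2 l M.initial

/-- `z` minimizes the P2LP objective function over the set `S`. -/
def IsOptimalOn (S : Set ((D.Col → ℝ) × (Fin D.L → M.Var → ℝ)))
    (z : (D.Col → ℝ) × (Fin D.L → M.Var → ℝ)) : Prop :=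
  z ∈ S ∧ ∀ z' ∈ S, D.objective z ≤ D.objective z'

/-- The box `[lo, hi]` for the vector `β`. -/
def InBox (lo hi β : D.Col → ℝ) : Prop := ∀ c, lo c ≤ β c ∧ β c ≤ hi c

/-- The feasible set of the linear program of the block `p` in an iteration of the idealized method:
`prev` is the vector of the previous iteration and `cur` the one of the current iteration, of which
only the blocks before `p` are used. -/
def blockFeasible {P : ℕ} (blk : M.Site → Fin P) (lo hi prev cur : D.Col → ℝ) (p : Fin P) :
    Set ((D.Col → ℝ) × (Fin D.L → M.Var → ℝ)) :=
  {z | z ∈ D.feasible W ∧ D.InBox lo hi z.1 ∧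
    (∀ c, blk c.1 < p → z.1 c = cur c) ∧ (∀ c, p < blk c.1 → z.1 c = prev c)}

/-- `β 0, β 1, …` is a sequence generated by the idealized cyclic block coordinate descent method:
the `p`-th block of `β (h + 1)` is the `p`-th block of an optimal solution of the linear program of
the block `p`. -/
def IsCBCDSequence {P : ℕ} (blk : M.Site → Fin P) (lo hi : D.Col → ℝ)
    (β : ℕ → D.Col → ℝ) : Prop :=
  D.InBox lo hi (β 0) ∧
  ∀ (h : ℕ) (p : Fin P), ∃ z,
    D.IsOptimalOn (D.blockFeasible W blk lo hi (β h) (β (h + 1)) p) z ∧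
      ∀ c, blk c.1 = p → β (h + 1) c = z.1 c

/-- The linear program solved for each block in each iteration has a unique optimal vector `β`. -/
def HasUniqueBlockSolutions {P : ℕ} (blk : M.Site → Fin P) (lo hi : D.Col → ℝ)
    (β : ℕ → D.Col → ℝ) : Prop :=
  ∀ (h : ℕ) (p : Fin P), ∀ z z',
    D.IsOptimalOn (D.blockFeasible W blk lo hi (β h) (β (h + 1)) p) z →
    D.IsOptimalOn (D.blockFeasible W blk lo hi (β h) (β (h + 1)) p) z' →
    z.1 = z'.1

end Samples

end EnergyPO

end

noncomputable section

namespace EnergyPO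

/-! Every transition moves to a strictly later stage and carries a nonnegative weight, so each path
LP has a componentwise least feasible solution, given by backward induction. Hence `OBJ` is the P2LP
objective minimized over `U`, and it is a maximum of finitely many affine functions of `β`
(`isMaxAffine_OBJ`). The method is then exact cyclic block minimization of a convex piecewise affine
function over a box.

For (a), a unique minimizer of such a function over a face of the box is sharp: the function grows
at least linearly away from it. The slope depends only on the active pieces, the free coordinates
and the tight bounds. These take finitely many values, so a single modulus serves all iterations
(`exists_uniform_sharpness`). Each iteration thus lowers `OBJ` by a fixed multiple of its step
length. Since `OBJ` is bounded below, the step lengths are summable and the sequence is Cauchy. A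
zero decrease forces a zero step, and uniqueness then keeps the sequence fixed.

For (b), continuity makes the limit a blockwise minimizer. Blockwise minimality alone does not
suffice for a nonsmooth function. However, at a non-degenerate optimum the active rows form an
invertible system, so each path value is affine near the limit, with an affine part that is a global
minorant (`exists_local_affine`). Coordinatewise minimality at an interior point makes the total
slope vanish, and the minorants then give global optimality. -/

/-- `f` is the pointwise maximum of a finite family of affine functions `x ↦ k.1 ⬝ᵥ x + k.2`. -/
def IsMaxAffineOf {ι : Type*} [Fintype ι] (K : Finset ((ι → ℝ) × ℝ)) (f : (ι → ℝ) → ℝ) : Prop :=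
  (∀ k ∈ K, ∀ x, k.1 ⬝ᵥ x + k.2 ≤ f x) ∧ ∀ x, ∃ k ∈ K, f x = k.1 ⬝ᵥ x + k.2

/-- `f` is a maximum of finitely many affine functions. -/
def IsMaxAffine {ι : Type*} [Fintype ι] (f : (ι → ℝ) → ℝ) : Prop :=
  ∃ K, IsMaxAffineOf K f

/-! ### Cones of feasible directions in a box -/

section DirectionCone

variable {ι : Type*}

/-- The directions that vanish off `s`, are nonnegative on `lo` and nonpositive on `hi`. -/
def directionCone (s lo hi : Set ι) : Set (ι → ℝ) :=
  {d | (∀ c, c ∉ s → d c = 0) ∧ (∀ c ∈ lo, 0 ≤ d c) ∧ ∀ c ∈ hi, d c ≤ 0}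

theorem isClosed_directionCone (s lo hi : Set ι) : IsClosed (directionCone s lo hi) := by
  have : directionCone s lo hi = (⋂ c, ⋂ (_ : c ∉ s), {d | d c = 0}) ∩
      ((⋂ c ∈ lo, {d | 0 ≤ d c}) ∩ ⋂ c ∈ hi, {d | d c ≤ 0}) := by
    ext d; simp [directionCone]
  rw [this]
  refine (isClosed_iInter fun c => isClosed_iInter fun _ => ?_).inter
    ((isClosed_iInter fun c => isClosed_iInter fun _ => ?_).inter
      (isClosed_iInter fun c => isClosed_iInter fun _ => ?_))
  · exact isClosed_eq (continuous_apply c) continuous_const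
  · exact isClosed_le continuous_const (continuous_apply c)
  · exact isClosed_le (continuous_apply c) continuous_const

theorem smul_mem_directionCone {s lo hi : Set ι} {d : ι → ℝ} (hd : d ∈ directionCone s lo hi)
    {t : ℝ} (ht : 0 ≤ t) : t • d ∈ directionCone s lo hi := by
  refine ⟨fun c hc => by simp [hd.1 c hc], fun c hc => ?_, fun c hc => ?_⟩
  · exact mul_nonneg ht (hd.2.1 c hc)
  · exact mul_nonpos_of_nonneg_of_nonpos ht (hd.2.2 c hc)

end DirectionCone

/-! ### Maxima of affine functions and sharp minima -/

section MaxAffine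

variable {ι : Type*} [Fintype ι]

theorem isMaxAffine_affine (a : ι → ℝ) (c : ℝ) : IsMaxAffine (fun x => a ⬝ᵥ x + c) :=
  ⟨{(a, c)}, by simp, by simp⟩

theorem isMaxAffine_const (c : ℝ) : IsMaxAffine (fun _ : ι → ℝ => c) := by
  simpa using isMaxAffine_affine (0 : ι → ℝ) c

theorem IsMaxAffine.add {f g : (ι → ℝ) → ℝ} (hf : IsMaxAffine f) (hg : IsMaxAffine g) :
    IsMaxAffine (fun x => f x + g x) := by
  classical
  obtain ⟨K, hK, hK'⟩ := hf
  obtain ⟨J, hJ, hJ'⟩ := hg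
  refine ⟨Finset.image₂ (fun k j => k + j) K J, ?_, fun x => ?_⟩
  · intro m hm x
    obtain ⟨k, hk, j, hj, rfl⟩ := Finset.mem_image₂.1 hm
    have h1 := hK k hk x
    have h2 := hJ j hj x
    simp only [Prod.fst_add, Prod.snd_add, add_dotProduct]
    linarith
  · obtain ⟨k, hk, h1⟩ := hK' x
    obtain ⟨j, hj, h2⟩ := hJ' x
    refine ⟨k + j, Finset.mem_image₂_of_mem hk hj, ?_⟩
    simp only [Prod.fst_add, Prod.snd_add, add_dotProduct]
    linarith

theorem IsMaxAffine.const_mul {f : (ι → ℝ) → ℝ} (hf : IsMaxAffine f) {t : ℝ} (ht : 0 ≤ t) :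
    IsMaxAffine (fun x => t * f x) := by
  classical
  obtain ⟨K, hK, hK'⟩ := hf
  refine ⟨K.image (fun k => t • k), ?_, fun x => ?_⟩
  · intro m hm x
    obtain ⟨k, hk, rfl⟩ := Finset.mem_image.1 hm
    have h1 := mul_le_mul_of_nonneg_left (hK k hk x) ht
    simp only [Prod.smul_fst, Prod.smul_snd, smul_dotProduct, smul_eq_mul]
    linarith
  · obtain ⟨k, hk, h1⟩ := hK' x
    refine ⟨t • k, Finset.mem_image_of_mem _ hk, ?_⟩
    simp only [Prod.smul_fst, Prod.smul_snd, smul_dotProduct, smul_eq_mul, h1]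
    ring

theorem isMaxAffine_sum {κ : Type*} (s : Finset κ) {f : κ → (ι → ℝ) → ℝ}
    (hf : ∀ k ∈ s, IsMaxAffine (f k)) : IsMaxAffine (fun x => ∑ k ∈ s, f k x) := by
  classical
  induction s using Finset.induction_on with
  | empty => simpa using isMaxAffine_const (ι := ι) 0
  | insert k s hk ih =>
    simp only [Finset.sum_insert hk]
    exact (hf k (by simp)).add (ih fun j hj => hf j (by simp [hj]))

theorem isMaxAffine_sup' {κ : Type*} (s : Finset κ) (hs : s.Nonempty) {f : κ → (ι → ℝ) → ℝ}
    (hf : ∀ k ∈ s, IsMaxAffine (f k)) : IsMaxAffine (fun x => s.sup' hs fun k => f k x) := by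
  classical
  choose! K hK hK' using hf
  refine ⟨s.biUnion K, ?_, fun x => ?_⟩
  · intro m hm x
    obtain ⟨k, hk, hm⟩ := Finset.mem_biUnion.1 hm
    exact (hK k hk m hm x).trans (Finset.le_sup' (fun k => f k x) hk)
  · obtain ⟨k, hk, h⟩ := Finset.exists_mem_eq_sup' hs (fun k => f k x)
    obtain ⟨m, hm, h'⟩ := hK' k hk x
    exact ⟨m, Finset.mem_biUnion.2 ⟨k, hk, hm⟩, h.trans h'⟩

theorem IsMaxAffine.continuous {f : (ι → ℝ) → ℝ} (hf : IsMaxAffine f) : Continuous f := by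
  obtain ⟨K, hK, hK'⟩ := hf
  obtain ⟨k₀, hk₀, -⟩ := hK' 0
  have hne : K.Nonempty := ⟨k₀, hk₀⟩
  have : f = fun x => K.sup' hne fun k => k.1 ⬝ᵥ x + k.2 := by
    funext x
    obtain ⟨k, hk, h⟩ := hK' x
    refine le_antisymm (h.trans_le (Finset.le_sup' (fun k => k.1 ⬝ᵥ x + k.2) hk)) ?_
    exact Finset.sup'_le _ _ fun k hk => hK k hk x
  rw [this]
  refine Continuous.finset_sup'_apply _ fun k _ => ?_
  unfold dotProduct
  fun_prop

/-- A constraint that weakens as a positive constant decreases can be met simultaneously for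
finitely many instances. -/
theorem exists_pos_forall_of_finite {T : Type*} [Finite T] {p : T → ℝ → Prop}
    (hp : ∀ τ a b, b ≤ a → p τ a → p τ b) (h : ∀ τ, ∃ a > 0, p τ a) : ∃ a > 0, ∀ τ, p τ a := by
  cases nonempty_fintype T
  choose a ha hpa using h
  rcases isEmpty_or_nonempty T with hT | hT
  · exact ⟨1, one_pos, fun τ => hT.elim τ⟩
  · obtain ⟨τ, -, hτ⟩ := Finset.exists_min_image Finset.univ a Finset.univ_nonempty
    exact ⟨a τ, ha τ, fun σ => hp σ _ _ (hτ σ (Finset.mem_univ _)) (hpa σ)⟩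

/-- A maximum of linear functions that is positive on a closed cone of directions is bounded below
there by a positive multiple of the norm. -/
theorem exists_pos_mul_norm_le (A : Finset ((ι → ℝ) × ℝ)) (s lo hi : Set ι)
    (h : ∀ d ∈ directionCone s lo hi, d ≠ 0 → ∃ k ∈ A, 0 < k.1 ⬝ᵥ d) :
    ∃ α > 0, ∀ d ∈ directionCone s lo hi, d ≠ 0 → ∃ k ∈ A, α * ‖d‖ ≤ k.1 ⬝ᵥ d := by
  set C := directionCone s lo hi ∩ Metric.sphere 0 1 with hC
  have hcomp : IsCompact C := (isCompact_sphere _ _).inter_left (isClosed_directionCone s lo hi)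
  have hnorm : ∀ d ∈ directionCone s lo hi, d ≠ 0 → ‖d‖⁻¹ • d ∈ C := fun d hd hd0 =>
    ⟨smul_mem_directionCone hd (by positivity), by simp [norm_smul, hd0]⟩
  rcases C.eq_empty_or_nonempty with hCe | hCne
  · refine ⟨1, one_pos, fun d hd hd0 => ?_⟩
    have := hnorm d hd hd0
    simp [hCe] at this
  have hne0 : ∀ d ∈ C, d ≠ 0 := by
    rintro d ⟨-, hd⟩ rfl
    simp at hd
  obtain ⟨d₁, hd₁⟩ := hCne
  obtain ⟨k₁, hk₁, -⟩ := h d₁ hd₁.1 (hne0 _ hd₁)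
  have hA : A.Nonempty := ⟨k₁, hk₁⟩
  have hcont : Continuous fun d : ι → ℝ => A.sup' hA fun k => k.1 ⬝ᵥ d := by
    refine Continuous.finset_sup'_apply _ fun k _ => ?_
    unfold dotProduct
    fun_prop
  obtain ⟨d₀, hd₀, hmin⟩ := hcomp.exists_isMinOn ⟨d₁, hd₁⟩ hcont.continuousOn
  -- The modulus is the minimum of the maximum over the compact set of unit directions; homogeneity
  -- extends the bound to the cone.
  refine ⟨A.sup' hA fun k => k.1 ⬝ᵥ d₀, ?_, fun d hd hd0 => ?_⟩
  · obtain ⟨k, hk, hpos⟩ := h d₀ hd₀.1 (hne0 _ hd₀)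
    exact hpos.trans_le (Finset.le_sup' (fun k => k.1 ⬝ᵥ d₀) hk)
  · have hle := hmin (hnorm d hd hd0)
    obtain ⟨k, hk, hkeq⟩ := Finset.exists_mem_eq_sup' hA (fun k => k.1 ⬝ᵥ (‖d‖⁻¹ • d))
    refine ⟨k, hk, ?_⟩
    have hpos : 0 < ‖d‖ := norm_pos_iff.2 hd0
    simp only [Set.mem_ofPred_eq] at hle
    rw [hkeq, dotProduct_smul, smul_eq_mul, inv_mul_eq_div, le_div_iff₀ hpos] at hle
    exact hle

/-- Unique minimizers of a maximum of finitely many affine functions over the coordinate faces of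
a box are sharp, with a modulus that depends neither on the minimizer nor on the face. -/
theorem IsMaxAffine.exists_uniform_sharpness {f : (ι → ℝ) → ℝ} (hf : IsMaxAffine f)
    (lo hi : ι → ℝ) :
    ∃ α > 0, ∀ (s : Set ι) (x : ι → ℝ), (∀ c, lo c ≤ x c ∧ x c ≤ hi c) →
      (∀ y : ι → ℝ, (∀ c, lo c ≤ y c ∧ y c ≤ hi c) → (∀ c, c ∉ s → y c = x c) →
        f y ≤ f x → y = x) →
      ∀ y : ι → ℝ, (∀ c, lo c ≤ y c ∧ y c ≤ hi c) → (∀ c, c ∉ s → y c = x c) →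
        α * ‖y - x‖ ≤ f y - f x := by
  classical
  obtain ⟨K, hK, hK'⟩ := hf
  -- The index records a set of pieces, the free coordinates, and the coordinates at the lower and
  -- at the upper bound. Positivity is a premise inside `p`, so combinations without it impose
  -- nothing on the constant.
  obtain ⟨α, hα, hsharp⟩ := exists_pos_forall_of_finite
    (T := Finset K × Set ι × Set ι × Set ι)
    (p := fun τ α =>
      (∀ d ∈ directionCone τ.2.1 τ.2.2.1 τ.2.2.2, d ≠ 0 →
        ∃ k ∈ τ.1.map (Function.Embedding.subtype _), 0 < k.1 ⬝ᵥ d) →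
      ∀ d ∈ directionCone τ.2.1 τ.2.2.1 τ.2.2.2, d ≠ 0 →
        ∃ k ∈ τ.1.map (Function.Embedding.subtype _), α * ‖d‖ ≤ k.1 ⬝ᵥ d)
    (by
      intro τ a b hba h hpos d hd hd0
      obtain ⟨k, hk, hle⟩ := h hpos d hd hd0
      exact ⟨k, hk, (mul_le_mul_of_nonneg_right hba (norm_nonneg d)).trans hle⟩)
    (by
      intro τ
      by_cases h : ∀ d ∈ directionCone τ.2.1 τ.2.2.1 τ.2.2.2, d ≠ 0 →
        ∃ k ∈ τ.1.map (Function.Embedding.subtype _), 0 < k.1 ⬝ᵥ d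
      · obtain ⟨α, hα, h'⟩ := exists_pos_mul_norm_le _ _ _ _ h
        exact ⟨α, hα, fun _ => h'⟩
      · exact ⟨1, one_pos, fun h' => absurd h' h⟩)
  refine ⟨α, hα, fun s x hx huniq y hy hyx => ?_⟩
  rcases eq_or_ne y x with rfl | hne
  · simp
  have key := hsharp (Finset.univ.filter fun k : K => f x = k.1.1 ⬝ᵥ x + k.1.2, s,
    {c | x c = lo c}, {c | x c = hi c}) ?_ (y - x) ?_ (sub_ne_zero.2 hne)
  · obtain ⟨k, hk, hle⟩ := key
    obtain ⟨⟨k, hkK⟩, hk', rfl⟩ := Finset.mem_map.1 hk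
    have h1 := (Finset.mem_filter.1 hk').2
    have h2 := hK k hkK y
    simp only [Function.Embedding.subtype_apply, dotProduct_sub] at hle h1
    linarith
  · intro d hd hd0
    -- If no active piece increases along `d`, a short step along `d` stays in the box, and the
    -- inactive pieces, by continuity, stay below `f x`. The new point is then as good as `x`,
    -- against uniqueness.
    by_contra! hcon
    have hcoord : ∀ c, Tendsto (fun t : ℝ => x c + t * d c) (𝓝[>] 0) (𝓝 (x c)) := fun c => by
      have : Tendsto (fun t : ℝ => x c + t * d c) (𝓝 0) (𝓝 (x c + 0 * d c)) :=
        Continuous.tendsto (by fun_prop) 0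
      simpa using this.mono_left nhdsWithin_le_nhds
    have hlo : ∀ᶠ t in 𝓝[>] (0 : ℝ), ∀ c, lo c ≤ x c + t * d c := by
      refine eventually_all.2 fun c => ?_
      rcases (hx c).1.eq_or_lt with heq | hlt
      · filter_upwards [self_mem_nhdsWithin] with t ht
        have := mul_nonneg (le_of_lt ht) (hd.2.1 c heq.symm)
        linarith
      · exact ((hcoord c).eventually (lt_mem_nhds hlt)).mono fun t ht => le_of_lt ht
    have hhi : ∀ᶠ t in 𝓝[>] (0 : ℝ), ∀ c, x c + t * d c ≤ hi c := by
      refine eventually_all.2 fun c => ?_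
      rcases (hx c).2.eq_or_lt with heq | hlt
      · filter_upwards [self_mem_nhdsWithin] with t ht
        have := mul_nonpos_of_nonneg_of_nonpos (le_of_lt ht) (hd.2.2 c heq)
        linarith
      · exact ((hcoord c).eventually (gt_mem_nhds hlt)).mono fun t ht => le_of_lt ht
    have hpieces : ∀ᶠ t in 𝓝[>] (0 : ℝ), ∀ k : K, k.1.1 ⬝ᵥ (x + t • d) + k.1.2 ≤ f x := by
      refine eventually_all.2 fun k => ?_
      rcases (hK k.1 k.2 x).eq_or_lt with heq | hlt
      · have hle := hcon k.1 (Finset.mem_map.2 ⟨k, by simp [heq], rfl⟩)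
        filter_upwards [self_mem_nhdsWithin] with t ht
        have := mul_nonpos_of_nonneg_of_nonpos (le_of_lt ht) hle
        rw [dotProduct_add, dotProduct_smul, smul_eq_mul]
        linarith
      · have : Tendsto (fun t : ℝ => k.1.1 ⬝ᵥ x + t * (k.1.1 ⬝ᵥ d) + k.1.2) (𝓝 0)
            (𝓝 (k.1.1 ⬝ᵥ x + 0 * (k.1.1 ⬝ᵥ d) + k.1.2)) := Continuous.tendsto (by fun_prop) 0
        rw [zero_mul, add_zero] at this
        refine ((this.mono_left nhdsWithin_le_nhds).eventually (gt_mem_nhds hlt)).mono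
          fun t ht => ?_
        rw [dotProduct_add, dotProduct_smul, smul_eq_mul]
        exact le_of_lt ht
    obtain ⟨t, ⟨⟨h1, h2⟩, h3⟩, ht⟩ :=
      (((hlo.and hhi).and hpieces).and self_mem_nhdsWithin).exists
    have heq := huniq (x + t • d) (fun c => ⟨h1 c, h2 c⟩)
      (fun c hc => by simp [hd.1 c hc]) (by
        obtain ⟨k, hk, hfk⟩ := hK' (x + t • d)
        exact hfk.trans_le (h3 ⟨k, hk⟩))
    have ht0 : t ≠ 0 := ne_of_gt ht
    have : t • d = 0 := by simpa using heq
    exact hd0 ((smul_eq_zero.1 this).resolve_left ht0)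
  · refine ⟨fun c hc => by simp [hyx c hc], fun c hc => ?_, fun c hc => ?_⟩
    · have := (hy c).1
      simp only [Set.mem_ofPred_eq] at hc
      simp only [Pi.sub_apply]; linarith
    · have := (hy c).2
      simp only [Set.mem_ofPred_eq] at hc
      simp only [Pi.sub_apply]; linarith

end MaxAffine

/-! ### Backward induction for the path programs -/

namespace Plant

variable (M : Plant)

/-- The discounted transition weight from a row to a variable of a later stage. -/
def transition (ρ : M.Row) (v : M.Var) : ℝ :=
  if (v.1.1 : ℕ) = M.nextStage ρ.stage ρ.mode ρ.action ∧
    v.1.2 = nextMode ρ.mode ρ.action then M.δ else 0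

theorem transition_nonneg (ρ : M.Row) (v : M.Var) : 0 ≤ M.transition ρ v := by
  unfold transition
  split_ifs
  exacts [M.δ_pos.le, le_rfl]

theorem lt_nextStage (i : Fin M.I) (x : Mode) (a : Action) : (i : ℕ) < M.nextStage i x a := by
  have h1 := M.NM_pos
  have h2 := M.NR_pos
  cases x <;> cases a <;> simp only [nextStage] <;> omega

theorem transition_eq_zero_of_le {ρ : M.Row} {v : M.Var} (h : v.1.1 ≤ ρ.1.1.1.1) :
    M.transition ρ v = 0 := by
  unfold transition
  rw [if_neg]
  rintro ⟨h', -⟩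
  have := M.lt_nextStage ρ.stage ρ.mode ρ.action
  have h'' : (v.1.1 : ℕ) ≤ ρ.stage := h
  omega

theorem Qmat_mulVec (V : M.Var → ℝ) (ρ : M.Row) :
    (M.Qmat *ᵥ V) ρ = V ρ.1.1 - ∑ w, M.transition ρ w * V w := by
  simp [Matrix.mulVec, dotProduct, Qmat, transition, sub_mul, Finset.sum_sub_distrib]

theorem abandon_mem_actions (i : Fin M.I) (x : Mode) : Action.abandon ∈ M.actions i x := by
  unfold actions
  cases x <;> split_ifs <;> simp

/-- The rows of a given variable. -/
def rowsAt (v : M.Var) : Finset M.Row := Finset.univ.filter fun ρ => ρ.1.1 = v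

theorem rowsAt_nonempty (v : M.Var) : (M.rowsAt v).Nonempty :=
  ⟨⟨(v, .abandon), M.abandon_mem_actions _ _⟩, by simp [rowsAt]⟩

/-- The Bellman operator for the stage rewards `q`. -/
def bellman (q : M.Row → ℝ) (V : M.Var → ℝ) : M.Var → ℝ := fun v =>
  (M.rowsAt v).sup' (M.rowsAt_nonempty v) fun ρ => q ρ + ∑ w, M.transition ρ w * V w

/-- The optimal value function for the stage rewards `q`. -/
def value (q : M.Row → ℝ) : M.Var → ℝ := (M.bellman q)^[M.I] 0

theorem sum_transition_congr {V V' : M.Var → ℝ} (ρ : M.Row)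
    (h : ∀ w : M.Var, ρ.1.1.1.1 < w.1.1 → V w = V' w) :
    ∑ w, M.transition ρ w * V w = ∑ w, M.transition ρ w * V' w := by
  refine Finset.sum_congr rfl fun w _ => ?_
  rcases le_or_gt w.1.1 ρ.1.1.1.1 with hw | hw
  · simp [M.transition_eq_zero_of_le hw]
  · rw [h w hw]

/-- After `n` iterations the last `n` stages are settled, because a row only looks at later stages.
With `n = 0` there is no such stage. -/
theorem bellman_iterate_succ (q : M.Row → ℝ) (n : ℕ) (v : M.Var) (h : M.I ≤ n + v.1.1) :
    (M.bellman q)^[n + 1] 0 v = (M.bellman q)^[n] 0 v := by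
  induction n generalizing v with
  | zero => have := v.1.1.2; omega
  | succ n ih =>
    rw [Function.iterate_succ_apply', Function.iterate_succ_apply' _ n]
    refine Finset.sup'_congr _ rfl fun ρ hρ => ?_
    obtain rfl : ρ.1.1 = v := (Finset.mem_filter.1 hρ).2
    refine congrArg _ (M.sum_transition_congr ρ fun w hw => ?_)
    have : (ρ.1.1.1.1 : ℕ) < w.1.1 := hw
    rw [← Function.iterate_succ_apply' (M.bellman q) n]
    exact ih w (by omega)

theorem bellman_value (q : M.Row → ℝ) : M.bellman q (M.value q) = M.value q := by
  funext v
  have := M.bellman_iterate_succ q M.I v (by omega)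
  rwa [Function.iterate_succ_apply'] at this

theorem le_Qmat_mulVec_value (q : M.Row → ℝ) (ρ : M.Row) :
    q ρ ≤ (M.Qmat *ᵥ M.value q) ρ := by
  have h : M.bellman q (M.value q) ρ.1.1 = M.value q ρ.1.1 := by rw [bellman_value]
  have h' : q ρ + ∑ w, M.transition ρ w * M.value q w ≤ M.bellman q (M.value q) ρ.1.1 :=
    Finset.le_sup' (fun ρ => q ρ + ∑ w, M.transition ρ w * M.value q w)
      (by simp [rowsAt] : ρ ∈ M.rowsAt ρ.1.1)
  rw [Qmat_mulVec]
  linarith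

/-- A feasible `V` dominates its own Bellman update, and the operator is monotone. The initial
function `0` need not lie below `V`, so the induction compares only the stages already settled. -/
theorem value_le {q : M.Row → ℝ} {V : M.Var → ℝ} (hV : ∀ ρ, q ρ ≤ (M.Qmat *ᵥ V) ρ)
    (v : M.Var) : M.value q v ≤ V v := by
  suffices h : ∀ n (v : M.Var), M.I ≤ n + v.1.1 → (M.bellman q)^[n] 0 v ≤ V v from
    h _ v (by omega)
  intro n
  induction n with
  | zero => intro v hv; have := v.1.1.2; omega
  | succ n ih =>
    intro v hv
    rw [Function.iterate_succ_apply']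
    refine Finset.sup'_le _ _ fun ρ hρ => ?_
    obtain rfl : ρ.1.1 = v := (Finset.mem_filter.1 hρ).2
    have h1 := hV ρ
    rw [Qmat_mulVec] at h1
    have h2 : ∑ w, M.transition ρ w * (M.bellman q)^[n] 0 w ≤ ∑ w, M.transition ρ w * V w := by
      refine Finset.sum_le_sum fun w _ => ?_
      rcases le_or_gt w.1.1 ρ.1.1.1.1 with hw | hw
      · simp [M.transition_eq_zero_of_le hw]
      · refine mul_le_mul_of_nonneg_left (ih w ?_) (M.transition_nonneg _ _)
        have : (ρ.1.1.1.1 : ℕ) < w.1.1 := hw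
        omega
    linarith

/-- The recursion uses only sums, nonnegative multiples and finite maxima, all of which preserve the
class. -/
theorem isMaxAffine_value {ι : Type*} [Fintype ι] {q : (ι → ℝ) → M.Row → ℝ}
    (hq : ∀ ρ, IsMaxAffine fun x => q x ρ) (v : M.Var) :
    IsMaxAffine fun x => M.value (q x) v := by
  unfold value
  generalize M.I = n
  induction n generalizing v with
  | zero => exact isMaxAffine_const 0
  | succ n ih =>
    simp only [Function.iterate_succ_apply']
    exact isMaxAffine_sup' _ _ fun ρ _ => (hq ρ).add
      (isMaxAffine_sum _ fun w _ => (ih w).const_mul (M.transition_nonneg ρ w))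

end Plant

/-! ### The reduced objective `OBJ` -/

namespace Samples

variable {M : Plant} (D : Samples M)
variable (W : ∀ k : M.Site, Matrix (Fin (D.B k.stage)) (Fin (D.B k.stage)) ℝ)

/-- The least feasible solution of the linear program of sample path `l`. -/
def pathValue (l : Fin D.L) (β : D.Col → ℝ) : M.Var → ℝ :=
  M.value fun ρ => D.rhs l ρ - (D.Gperp W l *ᵥ β) ρ

theorem pathValue_mem (l : Fin D.L) (β : D.Col → ℝ) :
    D.pathValue W l β ∈ D.pathFeasible W l β := fun ρ => by
  have := M.le_Qmat_mulVec_value (fun ρ => D.rhs l ρ - (D.Gperp W l *ᵥ β) ρ) ρ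
  simp only [pathValue]
  linarith

theorem pathValue_le {l : Fin D.L} {β : D.Col → ℝ} {V : M.Var → ℝ}
    (hV : V ∈ D.pathFeasible W l β) (v : M.Var) : D.pathValue W l β v ≤ V v :=
  M.value_le (fun ρ => by have := hV ρ; linarith) v

/-- The infimum defining `OBJ` is attained at the least feasible solution, so `sInf` takes no
default value here. -/
theorem OBJ_eq (β : D.Col → ℝ) :
    D.OBJ W β = D.objective (β, fun l => D.pathValue W l β) := by
  unfold OBJ objective
  congr 1
  refine Finset.sum_congr rfl fun l _ => ?_
  refine IsLeast.csInf_eq ⟨⟨_, D.pathValue_mem W l β, rfl⟩, ?_⟩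
  rintro _ ⟨V, hV, rfl⟩
  exact D.pathValue_le W hV _

theorem OBJ_le_objective {z : (D.Col → ℝ) × (Fin D.L → M.Var → ℝ)} (hz : z ∈ D.feasible W) :
    D.OBJ W z.1 ≤ D.objective z := by
  rw [OBJ_eq]
  unfold objective
  exact mul_le_mul_of_nonneg_left
    (Finset.sum_le_sum fun l _ => D.pathValue_le W (hz l) _) (by positivity)

theorem isMaxAffine_OBJ : IsMaxAffine (D.OBJ W) := by
  have : D.OBJ W = fun β => (1 / (D.L : ℝ)) * ∑ l, D.pathValue W l β M.initial :=
    funext fun β => D.OBJ_eq W β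
  rw [this]
  refine (isMaxAffine_sum _ fun l _ => M.isMaxAffine_value (fun ρ => ?_) _).const_mul
    (by positivity)
  have h := isMaxAffine_affine (-(D.Gperp W l ρ)) (D.rhs l ρ)
  simp only [neg_dotProduct, neg_add_eq_sub] at h
  exact h

theorem pathValue_initial_eq {l : Fin D.L} {β : D.Col → ℝ} {V : M.Var → ℝ}
    (hV : D.IsPathOptimal W l β V) : V M.initial = D.pathValue W l β M.initial :=
  le_antisymm (hV.2 _ (D.pathValue_mem W l β)) (D.pathValue_le W hV.1 _)

end Samples

/-! ### Block updates and convergence under uniqueness -/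

namespace Samples

variable {M : Plant} (D : Samples M)
variable (W : ∀ k : M.Site, Matrix (Fin (D.B k.stage)) (Fin (D.B k.stage)) ℝ)

/-- The vector that agrees with `cur` on the first `n` blocks and with `prev` on the others. -/
def partialUpdate {P : ℕ} (blk : M.Site → Fin P) (prev cur : D.Col → ℝ) (n : ℕ) : D.Col → ℝ :=
  fun c => if (blk c.1 : ℕ) < n then cur c else prev c

section CBCD

variable {P : ℕ} {blk : M.Site → Fin P} {lo hi : D.Col → ℝ} {β : ℕ → D.Col → ℝ}

theorem partialUpdate_zero (prev cur : D.Col → ℝ) : D.partialUpdate blk prev cur 0 = prev := by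
  funext c; simp [partialUpdate]

theorem partialUpdate_last (prev cur : D.Col → ℝ) : D.partialUpdate blk prev cur P = cur := by
  funext c; simp [partialUpdate]

theorem partialUpdate_succ_of_ne (prev cur : D.Col → ℝ) {p : Fin P} {c : D.Col}
    (hc : blk c.1 ≠ p) :
    D.partialUpdate blk prev cur p c = D.partialUpdate blk prev cur (p + 1) c := by
  have : (blk c.1 : ℕ) ≠ p := fun h => hc (Fin.ext h)
  unfold partialUpdate
  split_ifs <;> first | rfl | omega

variable {D W}

theorem IsCBCDSequence.inBox (hβ : D.IsCBCDSequence W blk lo hi β) (h : ℕ) :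
    D.InBox lo hi (β h) := by
  cases h with
  | zero => exact hβ.1
  | succ h =>
    intro c
    obtain ⟨z, hz, hzc⟩ := hβ.2 h (blk c.1)
    rw [hzc c rfl]
    exact hz.1.2.1 c

theorem IsCBCDSequence.inBox_partialUpdate (hβ : D.IsCBCDSequence W blk lo hi β) (h n : ℕ) :
    D.InBox lo hi (D.partialUpdate blk (β h) (β (h + 1)) n) := by
  intro c
  unfold partialUpdate
  split_ifs
  exacts [hβ.inBox _ c, hβ.inBox _ c]

/-- Completing `y` by the least path solutions turns comparisons of `OBJ` into comparisons inside
the block program. -/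
theorem mem_blockFeasible {prev cur y : D.Col → ℝ} {p : Fin P} (hy : D.InBox lo hi y)
    (hyp : ∀ c, blk c.1 ≠ p → y c = D.partialUpdate blk prev cur (p + 1) c) :
    (y, fun l => D.pathValue W l y) ∈ D.blockFeasible W blk lo hi prev cur p := by
  refine ⟨fun l => D.pathValue_mem W l y, hy, fun c hc => ?_, fun c hc => ?_⟩
  · have : (blk c.1 : ℕ) < p := hc
    exact (hyp c hc.ne).trans (by rw [partialUpdate, if_pos (by omega)])
  · have : (p : ℕ) < blk c.1 := hc
    exact (hyp c hc.ne').trans (by rw [partialUpdate, if_neg (by omega)])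

/-- The method prescribes only block `p` of the solution; the equality constraints fix the other
blocks. -/
theorem IsCBCDSequence.exists_isOptimalOn (hβ : D.IsCBCDSequence W blk lo hi β) (h : ℕ)
    (p : Fin P) : ∃ z, D.IsOptimalOn (D.blockFeasible W blk lo hi (β h) (β (h + 1)) p) z ∧
      z.1 = D.partialUpdate blk (β h) (β (h + 1)) (p + 1) := by
  obtain ⟨z, hz, hzc⟩ := hβ.2 h p
  refine ⟨z, hz, funext fun c => ?_⟩
  unfold partialUpdate
  rcases lt_trichotomy (blk c.1) p with hlt | heq | hgt
  · have : (blk c.1 : ℕ) < p := hlt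
    rw [if_pos (by omega), hz.1.2.2.1 c hlt]
  · rw [if_pos (by rw [heq]; omega), hzc c heq]
  · have : (p : ℕ) < blk c.1 := hgt
    rw [if_neg (by omega), hz.1.2.2.2 c hgt]

/-- Each partial update minimizes `OBJ` over the block that was updated last. -/
theorem IsCBCDSequence.OBJ_partialUpdate_le (hβ : D.IsCBCDSequence W blk lo hi β) (h : ℕ)
    (p : Fin P) {y : D.Col → ℝ} (hy : D.InBox lo hi y)
    (hyp : ∀ c, blk c.1 ≠ p → y c = D.partialUpdate blk (β h) (β (h + 1)) (p + 1) c) :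
    D.OBJ W (D.partialUpdate blk (β h) (β (h + 1)) (p + 1)) ≤ D.OBJ W y := by
  obtain ⟨z, hz, hzx⟩ := hβ.exists_isOptimalOn h p
  rw [← hzx, D.OBJ_eq W y]
  exact (D.OBJ_le_objective W hz.1.1).trans (hz.2 _ (mem_blockFeasible hy hyp))

theorem HasUniqueBlockSolutions.eq_partialUpdate
    (huniq : D.HasUniqueBlockSolutions W blk lo hi β) (hβ : D.IsCBCDSequence W blk lo hi β)
    (h : ℕ) (p : Fin P) {y : D.Col → ℝ} (hy : D.InBox lo hi y)
    (hyp : ∀ c, blk c.1 ≠ p → y c = D.partialUpdate blk (β h) (β (h + 1)) (p + 1) c)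
    (hle : D.OBJ W y ≤ D.OBJ W (D.partialUpdate blk (β h) (β (h + 1)) (p + 1))) :
    y = D.partialUpdate blk (β h) (β (h + 1)) (p + 1) := by
  obtain ⟨z, hz, hzx⟩ := hβ.exists_isOptimalOn h p
  rw [← hzx]
  refine huniq h p _ z ⟨mem_blockFeasible hy hyp, fun z' hz' => ?_⟩ hz
  rw [← D.OBJ_eq W y]
  rw [← hzx] at hle
  exact hle.trans ((D.OBJ_le_objective W hz.1.1).trans (hz.2 z' hz'))

/-- Under uniqueness, one iteration decreases `OBJ` by a fixed multiple of its step length. -/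
theorem HasUniqueBlockSolutions.exists_sufficient_decrease
    (huniq : D.HasUniqueBlockSolutions W blk lo hi β) (hβ : D.IsCBCDSequence W blk lo hi β) :
    ∃ α > 0, ∀ h, α * ‖β h - β (h + 1)‖ ≤ D.OBJ W (β h) - D.OBJ W (β (h + 1)) := by
  obtain ⟨α, hα, hsharp⟩ := (D.isMaxAffine_OBJ W).exists_uniform_sharpness lo hi
  refine ⟨α, hα, fun h => ?_⟩
  set w := D.partialUpdate blk (β h) (β (h + 1)) with hw
  have hn : ∀ n ≤ P, α * ‖w 0 - w n‖ ≤ D.OBJ W (w 0) - D.OBJ W (w n) := by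
    intro n
    induction n with
    | zero => simp
    | succ n ih =>
      intro hnP
      -- `w n` and `w (n + 1)` lie on the same face, on which `w (n + 1)` is the unique minimizer.
      -- The triangle inequality then adds up the block steps.
      have hstep := hsharp {c | blk c.1 = ⟨n, hnP⟩} (w (n + 1))
        (hβ.inBox_partialUpdate h _)
        (fun y hy hyx hle => huniq.eq_partialUpdate hβ h ⟨n, hnP⟩ hy hyx hle) (w n)
        (hβ.inBox_partialUpdate h _)
        (fun c hc => D.partialUpdate_succ_of_ne _ _ (p := ⟨n, hnP⟩) hc)
      have htri := mul_le_mul_of_nonneg_left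
        (norm_sub_le_norm_sub_add_norm_sub (w 0) (w n) (w (n + 1))) hα.le
      have := ih (by omega)
      linarith
  have := hn P le_rfl
  rwa [hw, D.partialUpdate_zero, D.partialUpdate_last] at this

theorem HasUniqueBlockSolutions.exists_tendsto
    (huniq : D.HasUniqueBlockSolutions W blk lo hi β) (hβ : D.IsCBCDSequence W blk lo hi β)
    {b : ℝ} (hb : ∀ x, b ≤ D.OBJ W x) : ∃ βlim, Tendsto β atTop (𝓝 βlim) := by
  obtain ⟨α, hα, hdec⟩ := huniq.exists_sufficient_decrease hβ
  have hstep : ∀ h, dist (β h) (β h.succ) ≤ (D.OBJ W (β h) - D.OBJ W (β (h + 1))) / α :=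
    fun h => by
      rw [le_div_iff₀ hα, dist_eq_norm, mul_comm]
      exact hdec h
  refine cauchySeq_tendsto_of_complete (cauchySeq_of_dist_le_of_summable _ hstep ?_)
  refine Summable.div_const ?_ α
  -- The decreases telescope, so their total is at most the initial gap to the lower bound.
  refine summable_of_sum_range_le (c := D.OBJ W (β 0) - b)
    (fun h => le_trans (by positivity) (hdec h)) fun n => ?_
  rw [Finset.sum_range_sub']
  linarith [hb (β n)]

theorem HasUniqueBlockSolutions.eq_succ_of_OBJ_eq
    (huniq : D.HasUniqueBlockSolutions W blk lo hi β) (hβ : D.IsCBCDSequence W blk lo hi β)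
    {h : ℕ} (hobj : D.OBJ W (β (h + 1)) = D.OBJ W (β h)) : β (h + 1) = β h := by
  obtain ⟨α, hα, hdec⟩ := huniq.exists_sufficient_decrease hβ
  have := hdec h
  rw [hobj, sub_self] at this
  have hz : ‖β h - β (h + 1)‖ ≤ 0 := nonpos_of_mul_nonpos_right this hα
  exact (sub_eq_zero.1 (norm_le_zero_iff.1 hz)).symm

/-- All partial updates of a stationary iteration coincide, so its block programs fix the same
values as those of the next iteration, as long as the latter has not moved. Uniqueness in iteration
`h` therefore rules out a first move. -/
theorem HasUniqueBlockSolutions.eq_succ_succ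
    (huniq : D.HasUniqueBlockSolutions W blk lo hi β) (hβ : D.IsCBCDSequence W blk lo hi β)
    {h : ℕ} (heq : β (h + 1) = β h) : β (h + 2) = β (h + 1) := by
  have hconst : ∀ n, D.partialUpdate blk (β h) (β (h + 1)) n = β (h + 1) := fun n => by
    funext c; simp [partialUpdate, heq]
  have hn : ∀ n ≤ P, D.partialUpdate blk (β (h + 1)) (β (h + 2)) n = β (h + 1) := by
    intro n
    induction n with
    | zero => intro _; exact D.partialUpdate_zero _ _
    | succ n ih =>
      intro hnP
      have ih := ih (by omega)
      have hoff : ∀ c : D.Col, blk c.1 ≠ ⟨n, hnP⟩ →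
          β (h + 1) c = D.partialUpdate blk (β (h + 1)) (β (h + 2)) (n + 1) c := fun c hc => by
        rw [← D.partialUpdate_succ_of_ne _ _ (p := ⟨n, hnP⟩) hc]
        exact (congrFun ih c).symm
      have hle := hβ.OBJ_partialUpdate_le (h + 1) ⟨n, hnP⟩ (hβ.inBox (h + 1)) hoff
      have := huniq.eq_partialUpdate hβ h ⟨n, hnP⟩ (hβ.inBox_partialUpdate (h + 1) (n + 1))
        (fun c hc => by rw [hconst]; exact (hoff c hc).symm) (by rw [hconst]; exact hle)
      rwa [hconst] at this
  rw [← hn P le_rfl, D.partialUpdate_last]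

theorem HasUniqueBlockSolutions.eq_of_OBJ_eq
    (huniq : D.HasUniqueBlockSolutions W blk lo hi β) (hβ : D.IsCBCDSequence W blk lo hi β)
    {h : ℕ} (hobj : D.OBJ W (β (h + 1)) = D.OBJ W (β h)) {k : ℕ} (hk : h ≤ k) : β k = β h := by
  suffices hs : ∀ k, h ≤ k → β (k + 1) = β k by
    induction k, hk using Nat.le_induction with
    | base => rfl
    | succ k hk ih => rw [hs k hk, ih]
  intro k hk
  induction k, hk using Nat.le_induction with
  | base => exact huniq.eq_succ_of_OBJ_eq hβ hobj
  | succ k hk ih => exact huniq.eq_succ_succ hβ ih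

/-- A limit of the method minimizes `OBJ` over each block of the box. -/
theorem IsCBCDSequence.OBJ_lim_le (hβ : D.IsCBCDSequence W blk lo hi β) {βlim : D.Col → ℝ}
    (hlim : Tendsto β atTop (𝓝 βlim)) (p : Fin P) {y : D.Col → ℝ} (hy : D.InBox lo hi y)
    (hyp : ∀ c, blk c.1 ≠ p → y c = βlim c) : D.OBJ W βlim ≤ D.OBJ W y := by
  classical
  set w := fun h => D.partialUpdate blk (β h) (β (h + 1)) (p + 1) with hw
  have hwlim : Tendsto w atTop (𝓝 βlim) := by
    refine tendsto_pi_nhds.2 fun c => ?_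
    have h1 := tendsto_pi_nhds.1 hlim c
    simp only [hw, partialUpdate]
    split_ifs
    exacts [h1.comp (tendsto_add_atTop_nat 1), h1]
  -- `y` itself need not be feasible in iteration `h`; the competitor takes block `p` from `y` and
  -- the rest from the iterate.
  have hylim : Tendsto (fun h c => if blk c.1 = p then y c else w h c) atTop (𝓝 y) := by
    refine tendsto_pi_nhds.2 fun c => ?_
    by_cases hc : blk c.1 = p
    · simp [hc]
    · simpa only [hc, if_false, hyp c hc] using tendsto_pi_nhds.1 hwlim c
  have hcont := (D.isMaxAffine_OBJ W).continuous
  refine le_of_tendsto_of_tendsto' ((hcont.tendsto _).comp hwlim)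
    ((hcont.tendsto _).comp hylim) fun h => ?_
  refine hβ.OBJ_partialUpdate_le h p (fun c => ?_) fun c hc => if_neg hc
  dsimp only
  split_ifs
  exacts [hy c, hβ.inBox_partialUpdate h _ c]

end CBCD

/-! ### Non-degeneracy and global optimality -/

section Nondegenerate

variable {D W}

/-- At a non-degenerate optimal solution the value of a path linear program is affine near `β`, and
this affine function is a global minorant. -/
theorem IsPathNondegenerate.exists_local_affine {l : Fin D.L} {β : D.Col → ℝ} {V : M.Var → ℝ}
    (hV : D.IsPathOptimal W l β V) (hnd : D.IsPathNondegenerate W l β V) :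
    ∃ γ : (D.Col → ℝ) →ₗ[ℝ] ℝ,
      (∀ β', D.pathValue W l β M.initial + γ (β' - β) ≤ D.pathValue W l β' M.initial) ∧
      ∀ᶠ β' in 𝓝 β,
        D.pathValue W l β' M.initial ≤ D.pathValue W l β M.initial + γ (β' - β) := by
  classical
  obtain ⟨hli, hcard⟩ := hnd
  rw [← D.pathValue_initial_eq W hV]
  set A := D.pathActive W l β V with hA
  have : Fintype A := Fintype.ofFinite A
  have hcard' : Fintype.card A = Fintype.card M.Var := by
    rw [← hcard, ← Nat.card_coe_set_eq, Nat.card_eq_fintype_card]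
  set QA : (M.Var → ℝ) →ₗ[ℝ] (A → ℝ) := (LinearMap.funLeft ℝ ℝ Subtype.val) ∘ₗ M.Qmat.mulVecLin
    with hQA
  set GA : (D.Col → ℝ) →ₗ[ℝ] (A → ℝ) :=
    (LinearMap.funLeft ℝ ℝ Subtype.val) ∘ₗ (D.Gperp W l).mulVecLin with hGA
  have hQA_apply : ∀ X (ρ : A), QA X ρ = (M.Qmat *ᵥ X) ρ := fun _ _ => rfl
  have hGA_apply : ∀ X (ρ : A), GA X ρ = (D.Gperp W l *ᵥ X) ρ := fun _ _ => rfl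
  -- Independent rows, as many as variables, span the space; a vector orthogonal to all of them is
  -- zero.
  have hinj : Function.Injective QA := by
    refine (injective_iff_map_eq_zero QA).2 fun X hX => ?_
    have hspan : Submodule.span ℝ (Set.range fun ρ : A => M.Qmat ρ.1) = ⊤ :=
      hli.span_eq_top_of_card_eq_finrank' (by rw [hcard', Module.finrank_fintype_fun_eq_card])
    have hort : ∀ Y ∈ Submodule.span ℝ (Set.range fun ρ : A => M.Qmat ρ.1), Y ⬝ᵥ X = 0 := by
      intro Y hY
      induction hY using Submodule.span_induction with
      | mem Y hY =>
        obtain ⟨ρ, rfl⟩ := hY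
        exact congrFun hX ρ
      | zero => exact zero_dotProduct X
      | add Y Z _ _ h1 h2 => rw [add_dotProduct, h1, h2, add_zero]
      | smul a Y _ h1 => rw [smul_dotProduct, h1, smul_zero]
    exact dotProduct_self_eq_zero.1 (hort X (hspan ▸ Submodule.mem_top))
  let e : (M.Var → ℝ) ≃ₗ[ℝ] (A → ℝ) := LinearEquiv.ofInjectiveOfFinrankEq QA hinj (by
    rw [Module.finrank_fintype_fun_eq_card, Module.finrank_fintype_fun_eq_card, hcard'])
  have he : ∀ X, e X = QA X := fun _ => rfl
  have hQE : ∀ s, QA (e.symm s) = s := fun s => by rw [← he, e.apply_symm_apply]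
  have hactive : ∀ ρ : A, (M.Qmat *ᵥ V) ρ + (D.Gperp W l *ᵥ β) ρ = D.rhs l ρ := fun ρ => ρ.2
  -- near `V`, only the active constraints can be violated
  have hfeas : ∀ (T : Type) [TopologicalSpace T] (F : Filter T) (t₀ : T) (X : T → M.Var → ℝ)
      (b : T → D.Col → ℝ), F ≤ 𝓝 t₀ → Continuous X → Continuous b → X t₀ = V → b t₀ = β →
      (∀ᶠ t in F, ∀ ρ : A, D.rhs l ρ ≤ QA (X t) ρ + GA (b t) ρ) →
      ∀ᶠ t in F, X t ∈ D.pathFeasible W l (b t) := by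
    intro T _ F t₀ X b hF hX hb hX0 hb0 hact
    have hina : ∀ᶠ t in F, ∀ ρ, ρ ∉ A →
        D.rhs l ρ ≤ (M.Qmat *ᵥ X t) ρ + (D.Gperp W l *ᵥ b t) ρ := by
      refine eventually_all.2 fun ρ => ?_
      by_cases hρ : ρ ∈ A
      · exact Eventually.of_forall fun t h => absurd hρ h
      have hlt : D.rhs l ρ < (M.Qmat *ᵥ X t₀) ρ + (D.Gperp W l *ᵥ b t₀) ρ := by
        rw [hX0, hb0]
        exact lt_of_le_of_ne (hV.1 ρ) fun h => hρ h.symm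
      have hc : Continuous fun t => (M.Qmat *ᵥ X t) ρ + (D.Gperp W l *ᵥ b t) ρ := by
        unfold Matrix.mulVec dotProduct
        fun_prop
      exact ((hc.tendsto t₀).mono_left hF |>.eventually (lt_mem_nhds hlt)).mono
        fun t ht _ => le_of_lt ht
    filter_upwards [hact, hina] with t h1 h2 ρ
    by_cases hρ : ρ ∈ A
    exacts [h1 ⟨ρ, hρ⟩, h2 ρ hρ]
  -- These numbers are the dual multipliers. Moving along `e.symm (Pi.single ρ 1)` loosens
  -- constraint `ρ` and keeps the other active ones tight, so optimality of `V` forbids a decrease.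
  have hdual : ∀ ρ : A, 0 ≤ e.symm (Pi.single ρ 1) M.initial := by
    intro ρ
    have hev := hfeas ℝ (𝓝[>] 0) 0 (fun t => V + t • e.symm (Pi.single ρ 1)) (fun _ => β)
      nhdsWithin_le_nhds (by fun_prop) continuous_const (by simp) rfl (by
        filter_upwards [self_mem_nhdsWithin] with t ht σ
        have hnn : (0 : ℝ) ≤ (Pi.single ρ 1 : A → ℝ) σ := by
          by_cases h : σ = ρ
          · subst h; simp
          · simp [h]
        have := mul_nonneg (le_of_lt ht) hnn
        simp only [map_add, map_smul, hQE, Pi.add_apply, Pi.smul_apply, smul_eq_mul]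
        rw [hQA_apply, hGA_apply, ← hactive σ]
        linarith)
    obtain ⟨t, hmem, ht⟩ := (hev.and self_mem_nhdsWithin).exists
    have := hV.2 _ hmem
    simp only [Pi.add_apply, Pi.smul_apply, smul_eq_mul] at this
    exact nonneg_of_mul_nonneg_right (by linarith) ht
  have hmono : ∀ s : A → ℝ, (∀ ρ, 0 ≤ s ρ) → 0 ≤ e.symm s M.initial := by
    intro s hs
    have : s = ∑ ρ, s ρ • (Pi.single ρ 1 : A → ℝ) := pi_eq_sum_univ' s
    rw [this, map_sum, Finset.sum_apply]
    refine Finset.sum_nonneg fun ρ _ => ?_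
    rw [map_smul, Pi.smul_apply, smul_eq_mul]
    exact mul_nonneg (hs ρ) (hdual ρ)
  -- The slope comes from solving the active equations for `U` as `β` varies. Nonnegative
  -- multipliers give the global lower bound; feasibility of the solved-for point near `β` gives the
  -- local upper bound.
  refine ⟨-(LinearMap.proj M.initial ∘ₗ e.symm.toLinearMap ∘ₗ GA), fun β' => ?_, ?_⟩
  · have hV' := D.pathValue_mem W l β'
    set V' := D.pathValue W l β'
    have h1 := hmono (QA (V' - V) + GA (β' - β)) fun ρ => by
      have h2 := hV' ρ
      rw [← hactive ρ] at h2
      simp only [map_sub, Pi.add_apply, Pi.sub_apply, hQA_apply, hGA_apply]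
      linarith
    rw [map_add, ← he, e.symm_apply_apply] at h1
    simp only [Pi.add_apply, Pi.sub_apply] at h1
    simp only [LinearMap.neg_apply, LinearMap.comp_apply, LinearMap.proj_apply,
      LinearEquiv.coe_coe]
    linarith
  · have hEc : Continuous fun d : D.Col → ℝ => e.symm (GA d) :=
      (e.symm.toLinearMap ∘ₗ GA).continuous_of_finiteDimensional
    have hev := hfeas (D.Col → ℝ) (𝓝 β) β (fun β' => V - e.symm (GA (β' - β))) (fun β' => β')
      le_rfl (continuous_const.sub (hEc.comp (continuous_id.sub continuous_const)))
      continuous_id (by simp) rfl (Eventually.of_forall fun β' ρ => by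
        simp only [map_sub, hQE, Pi.sub_apply]
        rw [← hactive ρ, hQA_apply, hGA_apply, hGA_apply]
        linarith)
    filter_upwards [hev] with β' hmem
    have := D.pathValue_le W hmem M.initial
    simp only [LinearMap.neg_apply, LinearMap.comp_apply, LinearMap.proj_apply,
      LinearEquiv.coe_coe]
    simpa [sub_eq_add_neg] using this

/-- If every path linear program at `β` has a non-degenerate optimal solution and `β` minimizes
`OBJ` along each coordinate near `β`, then `β` minimizes `OBJ`. -/
theorem OBJ_le_of_nondegenerate {β : D.Col → ℝ}
    (hnd : ∀ l, ∃ V, D.IsPathOptimal W l β V ∧ D.IsPathNondegenerate W l β V)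
    (hmin : ∀ c, ∀ᶠ t in 𝓝 (0 : ℝ), D.OBJ W β ≤ D.OBJ W (β + t • Pi.single c 1))
    (β' : D.Col → ℝ) : D.OBJ W β ≤ D.OBJ W β' := by
  choose V hV hVnd using hnd
  choose γ hge hle using fun l => (hVnd l).exists_local_affine (hV l)
  have hL : (0 : ℝ) < D.L := Nat.cast_pos.2 D.L_pos
  have hΓ : ∑ l, γ l = 0 := by
    refine LinearMap.pi_ext' fun c => LinearMap.ext_ring ?_
    -- Holding for `t` of both signs, this forces the slope along each coordinate to vanish.
    have hlocal : ∀ᶠ t in 𝓝 (0 : ℝ), 0 ≤ t * (∑ l, γ l) (Pi.single c 1) := by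
      have htend : Tendsto (fun t : ℝ => β + t • (Pi.single c 1 : D.Col → ℝ)) (𝓝 0) (𝓝 β) := by
        have : Tendsto (fun t : ℝ => β + t • (Pi.single c 1 : D.Col → ℝ)) (𝓝 0)
            (𝓝 (β + (0 : ℝ) • (Pi.single c 1 : D.Col → ℝ))) := Continuous.tendsto (by fun_prop) 0
        simpa using this
      filter_upwards [hmin c, htend.eventually (eventually_all.2 hle)] with t h1 h2
      rw [D.OBJ_eq, D.OBJ_eq] at h1
      have h3 := le_of_mul_le_mul_left h1 (by positivity)
      have h4 := h3.trans (Finset.sum_le_sum fun l _ => h2 l)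
      rw [Finset.sum_add_distrib] at h4
      simp only [add_sub_cancel_left, map_smul, smul_eq_mul, ← Finset.mul_sum] at h4
      rw [LinearMap.sum_apply]
      linarith
    obtain ⟨ε, hε, hball⟩ := Metric.eventually_nhds_iff.1 hlocal
    have h1 := hball (y := ε / 2) (by rw [Real.dist_eq, sub_zero, abs_of_pos] <;> linarith)
    have h2 := hball (y := -(ε / 2)) (by
      rw [Real.dist_eq, sub_zero, abs_neg, abs_of_pos] <;> linarith)
    have h3 := nonneg_of_mul_nonneg_right h1 (by linarith)
    have h4 : (∑ l, γ l) (Pi.single c 1) ≤ 0 := by nlinarith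
    simpa using le_antisymm h4 h3
  rw [D.OBJ_eq, D.OBJ_eq]
  refine mul_le_mul_of_nonneg_left ?_ (by positivity)
  have h := Finset.sum_le_sum fun l (_ : l ∈ Finset.univ) => hge l β'
  rwa [Finset.sum_add_distrib, ← LinearMap.sum_apply, hΓ, LinearMap.zero_apply, add_zero] at h

end Nondegenerate

end Samples

end EnergyPO

end

/-! ### The main theorem -/

theorem proposition3 (M : EnergyPO.Plant) (D : EnergyPO.Samples M)
    (W : ∀ k : M.Site, Matrix (Fin (D.B k.stage)) (Fin (D.B k.stage)) ℝ)
    (hW : D.IsBlockPCA W)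
    (P : ℕ) (blk : M.Site → Fin P) (hblk : Function.Surjective blk)
    (lo hi : D.Col → ℝ)
    (hbox : ∃ z, D.IsOptimalOn (D.feasible W) z ∧ D.InBox lo hi z.1)
    (β : ℕ → D.Col → ℝ) (hβ : D.IsCBCDSequence W blk lo hi β) :
    (D.HasUniqueBlockSolutions W blk lo hi β →
      (∃ βlim : D.Col → ℝ, Tendsto β atTop (𝓝 βlim)) ∧
      ∀ h, D.OBJ W (β (h + 1)) = D.OBJ W (β h) → ∀ k, h ≤ k → β k = β h) ∧
    ∀ βlim : D.Col → ℝ, Tendsto β atTop (𝓝 βlim) →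
      (∀ c, lo c < βlim c ∧ βlim c < hi c) →
      (∀ l, ∃ V, D.IsPathOptimal W l βlim V ∧ D.IsPathNondegenerate W l βlim V) →
      ∀ U : Fin D.L → M.Var → ℝ, (∀ l, D.IsPathOptimal W l βlim (U l)) →
        D.IsOptimalOn (D.feasible W) (βlim, U) := by
  refine ⟨fun huniq => ⟨?_, fun h hobj k hk => huniq.eq_of_OBJ_eq hβ hobj hk⟩, ?_⟩
  · obtain ⟨z, hz, -⟩ := hbox
    -- The optimal value of P2LP bounds `OBJ` from below everywhere, also outside the box.
    refine huniq.exists_tendsto hβ (b := D.objective z) fun x => ?_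
    rw [D.OBJ_eq]
    exact hz.2 _ fun l => D.pathValue_mem W l x
  · intro βlim hlim hint hnd U hU
    have hopt := EnergyPO.Samples.OBJ_le_of_nondegenerate hnd fun c => by
      -- Interiority lets each coordinate move in both directions within the box; such a move
      -- changes only one block.
      have hbd : ∀ᶠ t in 𝓝 (0 : ℝ), lo c < βlim c + t ∧ βlim c + t < hi c := by
        have : Tendsto (fun t : ℝ => βlim c + t) (𝓝 0) (𝓝 (βlim c + 0)) :=
          Continuous.tendsto (by fun_prop) 0
        rw [add_zero] at this
        exact (this.eventually (lt_mem_nhds (hint c).1)).and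
          (this.eventually (gt_mem_nhds (hint c).2))
      filter_upwards [hbd] with t ht
      refine hβ.OBJ_lim_le hlim (blk c.1) (fun c' => ?_) fun c' hc' => ?_
      · by_cases h : c' = c
        · subst h; simpa using ⟨ht.1.le, ht.2.le⟩
        · simpa [h] using ⟨(hint c').1.le, (hint c').2.le⟩
      · have h : c' ≠ c := fun h => hc' (by rw [h])
        simp [h]
    refine ⟨fun l => (hU l).1, fun z hz => ?_⟩
    -- Any optimal `U l` agrees with the least solution at the initial pair, the only entry in the
    -- objective.
    refine le_trans (le_of_eq ?_) ((hopt z.1).trans (D.OBJ_le_objective W hz))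
    rw [D.OBJ_eq]
    unfold EnergyPO.Samples.objective
    congr 1
    exact Finset.sum_congr rfl fun l _ => D.pathValue_initial_eq W (hU l)
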